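/- Let $(X,Y)$ be a random vector, $F$ and $G$ the distribution functions of $X$ and $Y$, and $\overline V=1-V$ the tail of a distribution function $V$. Assume that $Y>0$ almost surely, that $G$ is continuous, and that for some $\theta>0$ the vector $(X,Y)$ has the bivariate Frank distribution $$\mathrm P(X\le x,\,Y\le y)=-\frac1\theta\ln\Big(1+\frac{(e^{-\theta F(x)}-1)(e^{-\theta G(y)}-1)}{e^{-\theta}-1}\Big),\qquad x,y\in\mathbb R .$$ Put $$s(y)=\frac{\theta e^{-\theta\overline G(y)}}{1-e^{-\theta}} .$$ Let $\alpha\ge 0$ and suppose that $F$ is regularly-varying-tailed with index $\alpha$, i.e. $\lim_{x\to\infty}\overline F(xy)/\overline F(x)=y^{-\alpha}$ for each $y>0$. Let $L:(0,\infty)\to(0,\infty)$ be slowly varying at infinity (i.e. $\lim_{x\to\infty}L(xy)/L(x)=1$ for each $y>0$) with $\overline F(x)\sim x^{-\alpha}L(x)$ as $x\to\infty$. Suppose also that $\overline G(x)=o(\overline F(x))$ as $x\to\infty$, and that at least one of the following two conditions holds: (i) $\mathrm E\big[Y^{\alpha+\varepsilon}s(Y)\big]<\infty$ for some $\varepsilon>0$;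 (ii) $\mathrm E\big[Y^{\alpha}s(Y)\big]<\infty$, and there is a positive function $g$ on $[0,\infty)$ such that $g(x)$ is nonincreasing with limit $0$, $x\,g(x)$ is nondecreasing with limit $\infty$, $\overline G(x\,g(x))=o(\overline F(x))$ as $x\to\infty$, and $$\limsup_{x\to\infty}\ \sup_{1\le y\le x g(x)}\frac{L(x/y)}{L(x)}<\infty .$$ Then $\mathrm E[Y^\alpha s(Y)]<\infty$ and $$\mathrm P(XY>x)\sim \mathrm E\big[Y^\alpha s(Y)\big]\,\overline F(x)\qquad\text{as }x\to\infty .$$ -/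

import Mathlib

open MeasureTheory Filter Asymptotics
open scoped Topology

namespace BreimanFrank

noncomputable section

/-- Distribution function `x ↦ P(X ≤ x)` of a real random variable `X`. -/
def distFn {Ω : Type*} [MeasurableSpace Ω] (P : Measure Ω) (X : Ω → ℝ) : ℝ → ℝ :=
  fun x => ProbabilityTheory.cdf (P.map X) x

/-- Tail `1 - V` of a distribution function `V`. -/
def tail (V : ℝ → ℝ) : ℝ → ℝ := fun x => 1 - V x

/-- `V` is regularly-varying-tailed with index `α`. -/
def RegVaryingTail (V : ℝ → ℝ) (α : ℝ) : Prop :=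
  ∀ y : ℝ, 0 < y → Tendsto (fun x => tail V (x * y) / tail V x) atTop (𝓝 (y ^ (-α)))

/-- `L` is a positive function on `(0, ∞)` that varies slowly at infinity. -/
def SlowlyVarying (L : ℝ → ℝ) : Prop :=
  (∀ x : ℝ, 0 < x → 0 < L x) ∧
    ∀ y : ℝ, 0 < y → Tendsto (fun x => L (x * y) / L x) atTop (𝓝 1)

/-- `g` is a positive function on `[0, ∞)` with `g(x) ↓ 0`, `x g(x) ↑ ∞` and
`(1 - U)(x g(x)) = o((1 - V)(x))`, as `x → ∞`. -/
structure IsSeparating (U V g : ℝ → ℝ) : Prop where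
  pos : ∀ x : ℝ, 0 ≤ x → 0 < g x
  antitone : AntitoneOn g (Set.Ici 0)
  tendsto_zero : Tendsto g atTop (𝓝 0)
  mul_monotone : MonotoneOn (fun x => x * g x) (Set.Ici 0)
  mul_tendsto : Tendsto (fun x => x * g x) atTop atTop
  tail_isLittleO : (fun x => tail U (x * g x)) =o[atTop] tail V

/-- The quantity `limsup_{x → ∞} sup_{1 ≤ y ≤ x g(x)} L(x / y) / L(x)` is finite. -/
def RatioLimsupFinite (L g : ℝ → ℝ) : Prop :=
  ∃ C : ℝ, ∀ᶠ x in atTop, ∀ y : ℝ, 1 ≤ y → y ≤ x * g x → L (x / y) / L x ≤ C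

/-- `(X, Y)` has the bivariate Frank distribution with parameter `θ`. -/
def IsFrank {Ω : Type*} [MeasurableSpace Ω] (P : Measure Ω) (X Y : Ω → ℝ) (θ : ℝ) : Prop :=
  ∀ x y : ℝ, P.real {ω | X ω ≤ x ∧ Y ω ≤ y} =
    -(1 / θ) * Real.log (1 +
      (Real.exp (-θ * distFn P X x) - 1) * (Real.exp (-θ * distFn P Y y) - 1) /
        (Real.exp (-θ) - 1))

/-- The function `s(y) = θ exp(-θ (1 - G(y))) / (1 - exp(-θ))`. -/
def frankS (θ : ℝ) (G : ℝ → ℝ) : ℝ → ℝ :=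
  fun y => θ * Real.exp (-θ * tail G y) / (1 - Real.exp (-θ))

end

end BreimanFrank

/-! Conditioning on `Y` gives P(XY > x) = E[q(F(x/Y), G(Y))], where q(u, v) = 1 - ∂C(u, v)/∂v for
the Frank copula C (`real_lt_mul_eq_integral`). Since q(1, v) = 0 and -∂q/∂u at u = 1 is θ
e^{-θ(1-v)}/(1 - e^{-θ}), which is s(y) when v = G(y), regular variation makes the integrand divided
by the tail of F converge pointwise to Y^α s(Y) (`tendsto_frankTail_div`).

To pass to the limit, cut at Y = φ(x) (`tendsto_integral_frankTail_div`). Beyond the cut, q ≤ 1 and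
the tail of G at φ(x) is negligible. Below it, q(u, v) ≤ K(1 - u), and the tail ratio of F is at
most a constant times Y^β for Y ≥ 1, so dominated convergence applies. Under (i), φ(x) = x/x₀ and β
= α + ε by a Potter bound; under (ii), φ(x) = x g(x) and β = α by the bound on L. As s lies between
positive constants, weighting a moment by s does not affect its finiteness. -/

namespace BreimanFrank

open ProbabilityTheory Set

/-! ### The Frank copula and its conditional tail. -/

/-- The denominator `(1 - e^{-θ}) - (1 - e^{-θu})(1 - e^{-θv})` of the conditional Frank copula. -/
noncomputable def frankDen (θ u v : ℝ) : ℝ :=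
  (1 - Real.exp (-θ)) - (1 - Real.exp (-θ * u)) * (1 - Real.exp (-θ * v))

/-- The conditional tail `1 - ∂C(u, v)/∂v` of the Frank copula `C`. -/
noncomputable def frankTail (θ u v : ℝ) : ℝ :=
  (Real.exp (-θ * u) - Real.exp (-θ)) / frankDen θ u v

/-- The Frank copula. -/
noncomputable def frankCopula (θ u v : ℝ) : ℝ :=
  -(1 / θ) * Real.log (1 +
    (Real.exp (-θ * u) - 1) * (Real.exp (-θ * v) - 1) / (Real.exp (-θ) - 1))

lemma one_sub_exp_pos {θ : ℝ} (hθ : 0 < θ) : 0 < 1 - Real.exp (-θ) := by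
  have : Real.exp (-θ) < 1 := by simpa using hθ
  linarith

lemma exp_neg_mul_mem {θ u : ℝ} (hθ : 0 < θ) (hu : u ∈ Icc (0 : ℝ) 1) :
    Real.exp (-θ * u) ∈ Icc (Real.exp (-θ)) 1 := by
  constructor
  · apply Real.exp_le_exp.2; nlinarith [hu.1, hu.2]
  · apply Real.exp_le_one_iff.2; nlinarith [hu.1, hu.2]

/-- Since 1 - e^{-θu} ≤ 1 - e^{-θ}, the denominator is at least (1 - e^{-θ}) e^{-θv}. A bound
uniform in u and v is what makes the constant in `frankTail_le` uniform. -/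
lemma le_frankDen {θ u v : ℝ} (hθ : 0 < θ) (hu : u ∈ Icc (0 : ℝ) 1) (hv : v ∈ Icc (0 : ℝ) 1) :
    (1 - Real.exp (-θ)) * Real.exp (-θ) ≤ frankDen θ u v := by
  obtain ⟨h1, h2⟩ := exp_neg_mul_mem hθ hu
  obtain ⟨h3, h4⟩ := exp_neg_mul_mem hθ hv
  have := one_sub_exp_pos hθ
  unfold frankDen
  nlinarith [mul_nonneg (sub_nonneg.2 h1) (sub_nonneg.2 h4),
    mul_nonneg (sub_nonneg.2 h3) this.le]

lemma frankDen_pos {θ u v : ℝ} (hθ : 0 < θ) (hu : u ∈ Icc (0 : ℝ) 1) (hv : v ∈ Icc (0 : ℝ) 1) :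
    0 < frankDen θ u v :=
  (mul_pos (one_sub_exp_pos hθ) (Real.exp_pos _)).trans_le (le_frankDen hθ hu hv)

lemma frankTail_nonneg {θ u v : ℝ} (hθ : 0 < θ) (hu : u ∈ Icc (0 : ℝ) 1)
    (hv : v ∈ Icc (0 : ℝ) 1) : 0 ≤ frankTail θ u v :=
  div_nonneg (sub_nonneg.2 (exp_neg_mul_mem hθ hu).1) (frankDen_pos hθ hu hv).le

/-- Denominator minus numerator equals (1 - e^{-θu}) e^{-θv}. -/
lemma frankTail_le_one {θ u v : ℝ} (hθ : 0 < θ) (hu : u ∈ Icc (0 : ℝ) 1)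
    (hv : v ∈ Icc (0 : ℝ) 1) : frankTail θ u v ≤ 1 := by
  refine (div_le_one (frankDen_pos hθ hu hv)).2 ?_
  obtain ⟨h1, h2⟩ := exp_neg_mul_mem hθ hu
  obtain ⟨h3, h4⟩ := exp_neg_mul_mem hθ hv
  unfold frankDen
  nlinarith [mul_nonneg (sub_nonneg.2 h2) (Real.exp_pos (-θ * v)).le]

/-- The numerator is e^{-θu}(1 - e^{-θ(1-u)}), at most θ(1 - u). Uniformity in v makes this the
domination by the tail of X. -/
lemma frankTail_le {θ u v : ℝ} (hθ : 0 < θ) (hu : u ∈ Icc (0 : ℝ) 1) (hv : v ∈ Icc (0 : ℝ) 1) :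
    frankTail θ u v ≤ θ / ((1 - Real.exp (-θ)) * Real.exp (-θ)) * (1 - u) := by
  have h0 : Real.exp (-θ * u) - Real.exp (-θ) ≤ θ * (1 - u) := by
    have h1 := Real.add_one_le_exp (-θ * (1 - u))
    have h2 : Real.exp (-θ) = Real.exp (-θ * u) * Real.exp (-θ * (1 - u)) := by
      rw [← Real.exp_add]; ring_nf
    have h3 := (exp_neg_mul_mem hθ hu).2
    have h4 : 0 ≤ θ * (1 - u) := mul_nonneg hθ.le (sub_nonneg.2 hu.2)
    rw [h2]
    nlinarith [Real.exp_pos (-θ * u), mul_nonneg h4 (sub_nonneg.2 h3)]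
  calc frankTail θ u v ≤ (θ * (1 - u)) / ((1 - Real.exp (-θ)) * Real.exp (-θ)) :=
        div_le_div₀ (mul_nonneg hθ.le (sub_nonneg.2 hu.2)) h0
          (mul_pos (one_sub_exp_pos hθ) (Real.exp_pos _)) (le_frankDen hθ hu hv)
    _ = _ := by ring

lemma continuous_frankDen (θ : ℝ) : Continuous (fun p : ℝ × ℝ => frankDen θ p.1 p.2) := by
  unfold frankDen; fun_prop

lemma measurable_frankTail (θ : ℝ) : Measurable (fun p : ℝ × ℝ => frankTail θ p.1 p.2) :=
  Measurable.div (by fun_prop) (continuous_frankDen θ).measurable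

lemma continuousAt_frankTail_left {θ u v : ℝ} (hθ : 0 < θ) (hu : u ∈ Icc (0 : ℝ) 1)
    (hv : v ∈ Icc (0 : ℝ) 1) : ContinuousAt (fun u => frankTail θ u v) u :=
  ContinuousAt.div (by fun_prop)
    ((continuous_frankDen θ).comp (by fun_prop : Continuous fun u : ℝ => (u, v))).continuousAt
    (frankDen_pos hθ hu hv).ne'

lemma continuousOn_frankTail_right {θ u : ℝ} (hθ : 0 < θ) (hu : u ∈ Icc (0 : ℝ) 1) :
    ContinuousOn (fun v => frankTail θ u v) (Icc 0 1) :=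
  ContinuousOn.div (by fun_prop)
    ((continuous_frankDen θ).comp (by fun_prop : Continuous fun v : ℝ => (u, v))).continuousOn
    fun _ hv => (frankDen_pos hθ hu hv).ne'

lemma hasDerivAt_sub_frankCopula {θ u v : ℝ} (hθ : 0 < θ) (hu : u ∈ Icc (0 : ℝ) 1)
    (hv : v ∈ Icc (0 : ℝ) 1) :
    HasDerivAt (fun v => v - frankCopula θ u v) (frankTail θ u v) v := by
  have hc := one_sub_exp_pos hθ
  have hd := frankDen_pos hθ hu hv
  have hc' : Real.exp (-θ) - 1 ≠ 0 := by linarith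
  have harg : 1 + (Real.exp (-θ * u) - 1) * (Real.exp (-θ * v) - 1) / (Real.exp (-θ) - 1)
      = frankDen θ u v / (1 - Real.exp (-θ)) := by
    unfold frankDen
    field_simp
    ring
  have h1 : HasDerivAt (fun v => Real.exp (-θ * v)) (Real.exp (-θ * v) * (-θ)) v := by
    simpa using ((hasDerivAt_id v).const_mul (-θ)).exp
  have h2 := (((((h1.sub_const 1).const_mul (Real.exp (-θ * u) - 1)).div_const
    (Real.exp (-θ) - 1)).const_add 1).log
      (by rw [harg]; exact (div_pos hd hc).ne')).const_mul (-(1 / θ))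
  have h3 := (hasDerivAt_id v).sub h2
  refine h3.congr_deriv ?_
  rw [harg]
  unfold frankTail
  have hd' := hd.ne'
  have : Real.exp (-θ * u) - Real.exp (-θ) = frankDen θ u v
      - (1 - Real.exp (-θ * u)) * Real.exp (-θ * v) := by unfold frankDen; ring
  rw [this]
  have e : Real.exp (-θ) - 1 = -(1 - Real.exp (-θ)) := by ring
  rw [e]
  field_simp
  ring

lemma integral_frankTail {θ u b : ℝ} (hθ : 0 < θ) (hu : u ∈ Icc (0 : ℝ) 1)
    (hb : b ∈ Icc (0 : ℝ) 1) :
    ∫ v in (0 : ℝ)..b, frankTail θ u v = b - frankCopula θ u b := by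
  have hsub : uIcc 0 b ⊆ Icc 0 1 := by
    rw [uIcc_of_le hb.1]; exact Icc_subset_Icc_right hb.2
  rw [intervalIntegral.integral_eq_sub_of_hasDerivAt
    (fun v hv => hasDerivAt_sub_frankCopula hθ hu (hsub hv))
    ((continuousOn_frankTail_right hθ hu).mono hsub).intervalIntegrable]
  simp [frankCopula]

/-- First order expansion of the conditional tail at `u = 1`. -/
lemma tendsto_frankTail_div {ι : Type*} {l : Filter ι} {θ v ℓ : ℝ} (hθ : 0 < θ)
    (hv : v ∈ Icc (0 : ℝ) 1) {u h : ι → ℝ} (hu : Tendsto u l (𝓝 1))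
    (hh : Tendsto (fun i => (1 - u i) / h i) l (𝓝 ℓ)) :
    Tendsto (fun i => frankTail θ (u i) v / h i) l
      (𝓝 (ℓ * (θ * Real.exp (-θ * (1 - v)) / (1 - Real.exp (-θ))))) := by
  have hc := one_sub_exp_pos hθ
  have h1mem : (1 : ℝ) ∈ Icc (0 : ℝ) 1 := by simp
  have hd := frankDen_pos hθ h1mem hv
  have he : HasDerivAt (fun u => Real.exp (-θ * u)) (Real.exp (-θ * 1) * (-θ)) 1 := by
    simpa using ((hasDerivAt_id (1 : ℝ)).const_mul (-θ)).exp
  have hden : HasDerivAt (fun u => frankDen θ u v)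
      (Real.exp (-θ * 1) * (-θ) * (1 - Real.exp (-θ * v))) 1 := by
    unfold frankDen
    refine (((he.const_sub 1).mul_const (1 - Real.exp (-θ * v))).const_sub
      (1 - Real.exp (-θ))).congr_deriv ?_
    ring
  have hq : HasDerivAt (fun u => frankTail θ u v)
      (-(θ * Real.exp (-θ * (1 - v)) / (1 - Real.exp (-θ)))) 1 := by
    refine ((he.sub_const (Real.exp (-θ))).div hden hd.ne').congr_deriv ?_
    have e1 : frankDen θ 1 v = (1 - Real.exp (-θ)) * Real.exp (-θ * v) := by
      unfold frankDen; rw [mul_one]; ring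
    have e2 : Real.exp (-θ * (1 - v)) = Real.exp (-θ) / Real.exp (-θ * v) := by
      rw [← Real.exp_sub]; ring_nf
    rw [e1, e2, mul_one, sub_self]
    have := Real.exp_pos (-θ * v)
    field_simp
    ring
  -- `dslope` takes the derivative as its value at 1, so indices with `u i = 1` need no separate
  -- treatment.
  have hcont : ContinuousAt (dslope (fun u => frankTail θ u v) 1) 1 :=
    continuousAt_dslope_same.2 hq.differentiableAt
  have hlim := (hcont.tendsto.comp hu).neg.mul hh
  rw [dslope_same, hq.deriv, neg_neg, mul_comm] at hlim
  refine hlim.congr fun i => ?_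
  have h0 : frankTail θ 1 v = 0 := by simp [frankTail]
  have := sub_smul_dslope (fun u => frankTail θ u v) 1 (u i)
  rw [h0, sub_zero, smul_eq_mul] at this
  rw [← this]
  simp only [Function.comp_apply]
  ring

/-! ### Probability integral transform. -/

lemma cdf_mem_Icc (μ : Measure ℝ) (x : ℝ) : cdf μ x ∈ Icc (0 : ℝ) 1 :=
  ⟨cdf_nonneg μ x, cdf_le_one μ x⟩

/-- Probability integral transform: a continuous distribution function maps its law to the uniform
distribution on the unit interval. -/
lemma map_cdf_eq_uniform (μ : Measure ℝ) [IsProbabilityMeasure μ] (hG : Continuous (cdf μ)) :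
    μ.map (cdf μ) = volume.restrict (Icc (0 : ℝ) 1) := by
  refine Measure.ext_of_Iic _ _ fun v => ?_
  rw [Measure.map_apply hG.measurable measurableSet_Iic, Measure.restrict_apply measurableSet_Iic]
  rcases lt_or_ge v 0 with hv | hv0
  · have h1 : cdf μ ⁻¹' Iic v = ∅ := by
      ext y; simpa using hv.trans_le (cdf_nonneg μ y)
    have h2 : Iic v ∩ Icc (0 : ℝ) 1 = ∅ := by
      ext y; simp only [mem_inter_iff, mem_Iic, mem_Icc, mem_empty_iff_false, iff_false]
      rintro ⟨h, h', -⟩; linarith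
    simp [h1, h2]
  rcases le_or_gt 1 v with hv | hv1
  · have h1 : cdf μ ⁻¹' Iic v = univ := by
      ext y; simpa using (cdf_le_one μ y).trans hv
    have h2 : Iic v ∩ Icc (0 : ℝ) 1 = Icc 0 1 :=
      inter_eq_right.2 fun y hy => hy.2.trans hv
    simp [h1, h2]
  have h2 : Iic v ∩ Icc (0 : ℝ) 1 = Icc 0 v := by
    ext y; simp only [mem_inter_iff, mem_Iic, mem_Icc]
    exact ⟨fun h => ⟨h.2.1, h.1⟩, fun h => ⟨h.2, h.1, h.2.trans hv1.le⟩⟩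
  rw [h2, Real.volume_Icc, sub_zero]
  rcases (cdf μ ⁻¹' Iic v).eq_empty_or_nonempty with he | hne
  · have hv : v = 0 := by
      refine le_antisymm ?_ hv0
      by_contra! h
      obtain ⟨y, hy⟩ := ((tendsto_cdf_atBot μ).eventually_lt_const h).exists
      exact (he ▸ (show y ∈ cdf μ ⁻¹' Iic v from hy.le) : y ∈ (∅ : Set ℝ))
    rw [he, hv]; simp
  · obtain ⟨M, hM⟩ := ((tendsto_cdf_atTop μ).eventually_const_lt hv1).exists
    have hbdd : BddAbove (cdf μ ⁻¹' Iic v) := by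
      refine ⟨M, fun y hy => ?_⟩
      by_contra! h
      exact absurd (hM.trans_le (monotone_cdf μ h.le)) (not_lt.2 hy)
    -- The largest point where the distribution function is at most v; by continuity the value there
    -- is exactly v.
    set y := sSup (cdf μ ⁻¹' Iic v) with hy
    have hmem : cdf μ y ≤ v :=
      (isClosed_Iic.preimage hG).csSup_mem hne hbdd
    have hset : cdf μ ⁻¹' Iic v = Iic y := by
      ext z
      exact ⟨fun hz => le_csSup hbdd hz, fun hz => (monotone_cdf μ hz).trans hmem⟩
    have hge : v ≤ cdf μ y := by
      refine ge_of_tendsto (hG.tendsto y |>.mono_left (nhdsWithin_le_nhds (s := Ioi y))) ?_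
      filter_upwards [self_mem_nhdsWithin] with z hz
      by_contra! h
      exact absurd (le_csSup hbdd (show z ∈ cdf μ ⁻¹' Iic v from h.le)) (not_le.2 hz)
    rw [hset, ← ofReal_cdf, le_antisymm hmem hge]

/-- The set {G(y) ≤ G(b)} can exceed {y ≤ b} if G is flat to the right of b, but both have mass
G(b), so they agree almost everywhere and the uniform law applies. -/
lemma setLIntegral_Iic_comp_cdf (μ : Measure ℝ) [IsProbabilityMeasure μ]
    (hG : Continuous (cdf μ)) {f : ℝ → ENNReal} (hf : Measurable f) (b : ℝ) :
    ∫⁻ y in Iic b, f (cdf μ y) ∂μ = ∫⁻ v in Icc 0 (cdf μ b), f v := by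
  have hae : Iic b =ᵐ[μ] cdf μ ⁻¹' Iic (cdf μ b) := by
    refine ae_eq_of_subset_of_measure_ge (fun y hy => monotone_cdf μ hy) ?_
      measurableSet_Iic.nullMeasurableSet (measure_ne_top _ _)
    rw [← Measure.map_apply hG.measurable measurableSet_Iic, map_cdf_eq_uniform μ hG,
      Measure.restrict_apply measurableSet_Iic, ← ofReal_cdf]
    refine (measure_mono (t := Icc 0 (cdf μ b)) fun v hv => ⟨hv.2.1, hv.1⟩).trans ?_
    simp
  rw [setLIntegral_congr hae, ← setLIntegral_map measurableSet_Iic hf hG.measurable,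
    map_cdf_eq_uniform μ hG, Measure.restrict_restrict measurableSet_Iic]
  congr 2
  ext v
  exact ⟨fun hv => ⟨hv.2.1, hv.1⟩, fun hv => ⟨hv.2, hv.1, hv.2.trans (cdf_le_one μ b)⟩⟩

/-! ### Conditional law of X given Y, and the tail of the product. -/

section ConditionalTail

variable {Ω : Type*} [MeasurableSpace Ω] {P : Measure Ω} [IsProbabilityMeasure P] {X Y : Ω → ℝ}
  {θ : ℝ}

lemma distFn_eq_real (hX : Measurable X) (x : ℝ) : distFn P X x = P.real {ω | X ω ≤ x} := by
  have := Measure.isProbabilityMeasure_map (μ := P) hX.aemeasurable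
  rw [distFn, cdf_eq_real, map_measureReal_apply hX measurableSet_Iic]
  rfl

lemma tail_eq_real (hX : Measurable X) (x : ℝ) : tail (distFn P X) x = P.real {ω | x < X ω} := by
  have : {ω | x < X ω} = {ω | X ω ≤ x}ᶜ := by ext; simp
  rw [tail, distFn_eq_real hX, this,
    probReal_compl_eq_one_sub (measurableSet_le hX measurable_const)]

lemma distFn_mem_Icc (P : Measure Ω) (X : Ω → ℝ) (x : ℝ) : distFn P X x ∈ Icc (0 : ℝ) 1 :=
  cdf_mem_Icc _ x

lemma measure_lt_inter_le (hX : Measurable X) (hY : Measurable Y) (hXY : IsFrank P X Y θ)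
    (t b : ℝ) :
    P (Y ⁻¹' Iic b ∩ X ⁻¹' Ioi t) =
      ENNReal.ofReal (distFn P Y b - frankCopula θ (distFn P X t) (distFn P Y b)) := by
  have h1 : Y ⁻¹' Iic b ∩ X ⁻¹' Ioi t = {ω | Y ω ≤ b} \ {ω | X ω ≤ t ∧ Y ω ≤ b} := by
    ext ω
    simp only [mem_inter_iff, mem_preimage, mem_Iic, mem_Ioi, Set.mem_sdiff, mem_ofPred_eq, not_and]
    exact ⟨fun h => ⟨h.1, fun h' => absurd h' (not_le.2 h.2)⟩,
      fun h => ⟨h.1, not_le.1 fun h' => h.2 h' h.1⟩⟩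
  have hsub : {ω | X ω ≤ t ∧ Y ω ≤ b} ⊆ {ω | Y ω ≤ b} := fun ω h => h.2
  rw [← ofReal_measureReal, h1, measureReal_sdiff hsub
    ((measurableSet_le hX measurable_const).inter (measurableSet_le hY measurable_const)),
    hXY, distFn_eq_real hY b]
  rfl

/-- For each level, the conditional tail of `X` given `Y` is the conditional tail of the copula. -/
lemma condDistrib_Ioi_ae (hX : Measurable X) (hY : Measurable Y)
    (hG : Continuous (distFn P Y)) (hθ : 0 < θ) (hXY : IsFrank P X Y θ) (t : ℝ) :
    ∀ᵐ y ∂(P.map Y), condDistrib X Y P y (Ioi t) =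
      ENNReal.ofReal (frankTail θ (distFn P X t) (distFn P Y y)) := by
  have := Measure.isProbabilityMeasure_map (μ := P) hY.aemeasurable
  have hq : Measurable (fun v => ENNReal.ofReal (frankTail θ (distFn P X t) v)) :=
    ((measurable_frankTail θ).comp (by fun_prop : Measurable fun v : ℝ => (distFn P X t, v)))
      |>.ennreal_ofReal
  have hm1 : Measurable (fun y => condDistrib X Y P y (Ioi t)) :=
    Kernel.measurable_coe _ measurableSet_Ioi
  have hfin : ∫⁻ y, condDistrib X Y P y (Ioi t) ∂(P.map Y) ≠ ⊤ := by
    refine ne_top_of_le_ne_top ENNReal.one_ne_top ?_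
    calc _ ≤ ∫⁻ _, 1 ∂(P.map Y) := lintegral_mono fun y => prob_le_one
      _ = 1 := by simp
  -- Both functions are densities with respect to the law of Y; they agree almost everywhere once
  -- the measures they define agree on half-lines.
  refine (withDensity_eq_iff hm1.aemeasurable (hq.comp hG.measurable).aemeasurable hfin).1 ?_
  have := isFiniteMeasure_withDensity hfin
  refine Measure.ext_of_Iic _ _ fun b => ?_
  rw [withDensity_apply _ measurableSet_Iic, withDensity_apply _ measurableSet_Iic]
  have hl : ∫⁻ y in Iic b, condDistrib X Y P y (Ioi t) ∂(P.map Y) =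
      P (Y ⁻¹' Iic b ∩ X ⁻¹' Ioi t) := by
    rw [← setLIntegral_preimage_condDistrib hY hX.aemeasurable measurableSet_Ioi
      measurableSet_Iic, setLIntegral_map measurableSet_Iic hm1 hY]
  rw [hl, measure_lt_inter_le hX hY hXY]
  refine Eq.trans ?_ (setLIntegral_Iic_comp_cdf (P.map Y) hG hq b).symm
  have hu := distFn_mem_Icc P X t
  have hb := distFn_mem_Icc P Y b
  rw [← integral_frankTail hθ hu hb, intervalIntegral.integral_of_le hb.1,
    ← integral_Icc_eq_integral_Ioc, ofReal_integral_eq_lintegral_ofReal]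
  · rfl
  · exact ((continuousOn_frankTail_right hθ hu).mono (Icc_subset_Icc_right hb.2)).integrableOn_Icc
  · filter_upwards [ae_restrict_mem measurableSet_Icc] with v hv
    exact frankTail_nonneg hθ hu ⟨hv.1, hv.2.trans hb.2⟩

/-- The null set must not depend on the level, because the level used later is x/y. Rational levels
share one null set, and right-continuity in t extends the identity to real levels. -/
lemma ae_condDistrib_Ioi (hX : Measurable X) (hY : Measurable Y)
    (hG : Continuous (distFn P Y)) (hθ : 0 < θ) (hXY : IsFrank P X Y θ) :
    ∀ᵐ y ∂(P.map Y), ∀ t : ℝ, condDistrib X Y P y (Ioi t) =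
      ENNReal.ofReal (frankTail θ (distFn P X t) (distFn P Y y)) := by
  have hrat : ∀ᵐ y ∂(P.map Y), ∀ r : ℚ, condDistrib X Y P y (Ioi (r : ℝ)) =
      ENNReal.ofReal (frankTail θ (distFn P X r) (distFn P Y y)) :=
    ae_all_iff.2 fun r => condDistrib_Ioi_ae hX hY hG hθ hXY r
  filter_upwards [hrat] with y hy t
  have key : ∀ r : ℝ, condDistrib X Y P y (Ioi r) =
      ENNReal.ofReal (1 - cdf (condDistrib X Y P y) r) := by
    intro r
    rw [← compl_Iic, prob_compl_eq_one_sub measurableSet_Iic, ← ofReal_cdf,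
      ENNReal.ofReal_sub _ (cdf_nonneg _ _), ENNReal.ofReal_one]
  have hright : ∀ (ν : Measure ℝ), Tendsto (cdf ν) (𝓝[>] t) (𝓝 (cdf ν t)) := fun ν =>
    ((cdf ν).right_continuous t).tendsto.mono_left (nhdsWithin_mono _ Ioi_subset_Ici_self)
  have h1 : Tendsto (fun r => condDistrib X Y P y (Ioi r)) (𝓝[>] t)
      (𝓝 (condDistrib X Y P y (Ioi t))) := by
    simp_rw [key]
    exact (ENNReal.continuous_ofReal.tendsto _).comp ((hright _).const_sub 1)
  have h2 : Tendsto (fun r => ENNReal.ofReal (frankTail θ (distFn P X r) (distFn P Y y)))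
      (𝓝[>] t) (𝓝 (ENNReal.ofReal (frankTail θ (distFn P X t) (distFn P Y y)))) :=
    (ENNReal.continuous_ofReal.tendsto _).comp
      ((continuousAt_frankTail_left hθ (distFn_mem_Icc P X t)
        (distFn_mem_Icc P Y y)).tendsto.comp (hright (P.map X)))
  refine tendsto_nhds_unique_of_frequently_eq h1 h2 ?_
  rw [frequently_iff]
  intro U hU
  obtain ⟨c, hc, hcU⟩ := mem_nhdsGT_iff_exists_Ioo_subset.1 hU
  obtain ⟨r, hr1, hr2⟩ := exists_rat_btwn (show t < c from hc)
  exact ⟨r, hcU ⟨hr1, hr2⟩, hy r⟩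

lemma measurable_distFn (P : Measure Ω) (X : Ω → ℝ) : Measurable (distFn P X) :=
  (monotone_cdf (P.map X)).measurable

lemma measurable_frankTail_comp {S : Type*} [MeasurableSpace S] {Z : S → ℝ} (P : Measure Ω)
    (X Y : Ω → ℝ) (hZ : Measurable Z) (θ x : ℝ) :
    Measurable fun ω => frankTail θ (distFn P X (x / Z ω)) (distFn P Y (Z ω)) :=
  (measurable_frankTail θ).comp
    (((measurable_distFn P X).comp (measurable_const.div hZ)).prodMk
      ((measurable_distFn P Y).comp hZ))

/-- The tail of the product as an expectation of the conditional tail. -/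
lemma real_lt_mul_eq_integral (hX : Measurable X) (hY : Measurable Y)
    (hYpos : ∀ᵐ ω ∂P, 0 < Y ω) (hG : Continuous (distFn P Y)) (hθ : 0 < θ)
    (hXY : IsFrank P X Y θ) (x : ℝ) :
    P.real {ω | x < X ω * Y ω} =
      ∫ ω, frankTail θ (distFn P X (x / Y ω)) (distFn P Y (Y ω)) ∂P := by
  have := Measure.isProbabilityMeasure_map (μ := P) hY.aemeasurable
  have hs : MeasurableSet {p : ℝ × ℝ | x < p.2 * p.1} :=
    measurableSet_lt measurable_const (measurable_snd.mul measurable_fst)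
  have hpos : ∀ᵐ y ∂(P.map Y), 0 < y :=
    (ae_map_iff hY.aemeasurable measurableSet_Ioi).2 hYpos
  have h1 : P {ω | x < X ω * Y ω} =
      ∫⁻ ω, ENNReal.ofReal (frankTail θ (distFn P X (x / Y ω)) (distFn P Y (Y ω))) ∂P := by
    calc P {ω | x < X ω * Y ω}
        = (P.map fun ω => (Y ω, X ω)) {p : ℝ × ℝ | x < p.2 * p.1} := by
          rw [Measure.map_apply (hY.prodMk hX) hs]; rfl
      _ = ∫⁻ y, condDistrib X Y P y (Prod.mk y ⁻¹' {p : ℝ × ℝ | x < p.2 * p.1}) ∂(P.map Y) := by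
          rw [← compProd_map_condDistrib hX.aemeasurable, Measure.compProd_apply hs]
      _ = ∫⁻ y, ENNReal.ofReal (frankTail θ (distFn P X (x / y)) (distFn P Y y)) ∂(P.map Y) := by
          refine lintegral_congr_ae ?_
          filter_upwards [hpos, ae_condDistrib_Ioi hX hY hG hθ hXY] with y hy hcond
          rw [← hcond]
          congr 1
          ext z
          simp [div_lt_iff₀ hy]
      _ = _ := by
          rw [lintegral_map _ hY]
          exact (measurable_frankTail_comp P X Y measurable_id θ x).ennreal_ofReal
  rw [measureReal_def, h1, integral_eq_lintegral_of_nonneg_ae]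
  · exact ae_of_all _ fun ω => frankTail_nonneg hθ (distFn_mem_Icc _ _ _) (distFn_mem_Icc _ _ _)
  · exact (measurable_frankTail_comp P X Y hY θ x).aestronglyMeasurable

end ConditionalTail

/-! ### Tail estimates and dominated convergence. -/

section Asymptotics

variable {Ω : Type*} [MeasurableSpace Ω] {P : Measure Ω} {X Y : Ω → ℝ} {θ : ℝ}

lemma tail_nonneg (P : Measure Ω) (X : Ω → ℝ) (x : ℝ) : 0 ≤ tail (distFn P X) x :=
  sub_nonneg.2 (distFn_mem_Icc P X x).2

lemma antitone_tail (P : Measure Ω) (X : Ω → ℝ) : Antitone (tail (distFn P X)) :=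
  fun _ _ h => sub_le_sub_left (monotone_cdf (P.map X) h) 1

lemma tendsto_distFn_atTop (P : Measure Ω) (X : Ω → ℝ) :
    Tendsto (distFn P X) atTop (𝓝 1) := tendsto_cdf_atTop _

lemma RegVaryingTail.eventually_pos {α : ℝ} (hF : RegVaryingTail (distFn P X) α) :
    ∀ᶠ x in atTop, 0 < tail (distFn P X) x := by
  have h := hF 1 one_pos
  rw [Real.one_rpow] at h
  filter_upwards [h.eventually_ne one_ne_zero] with x hx
  refine (tail_nonneg P X x).lt_of_ne' fun h0 => hx ?_
  rw [h0, div_zero]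

lemma frankS_lower {θ : ℝ} (hθ : 0 < θ) (P : Measure Ω) (Y : Ω → ℝ) (y : ℝ) :
    θ * Real.exp (-θ) / (1 - Real.exp (-θ)) ≤ frankS θ (distFn P Y) y := by
  have hc := one_sub_exp_pos hθ
  unfold frankS
  gcongr
  have := (distFn_mem_Icc P Y y).1
  unfold tail
  nlinarith

lemma frankS_pos {θ : ℝ} (hθ : 0 < θ) (P : Measure Ω) (Y : Ω → ℝ) (y : ℝ) :
    0 < frankS θ (distFn P Y) y :=
  (div_pos (mul_pos hθ (Real.exp_pos _)) (one_sub_exp_pos hθ)).trans_le (frankS_lower hθ P Y y)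

lemma measurable_frankS (θ : ℝ) (P : Measure Ω) (Y : Ω → ℝ) :
    Measurable (frankS θ (distFn P Y)) := by
  have := measurable_distFn P Y
  unfold frankS tail
  fun_prop

lemma integrable_rpow_of_mul_frankS (hY : Measurable Y) (hθ : 0 < θ) {β : ℝ}
    (h : Integrable (fun ω => Y ω ^ β * frankS θ (distFn P Y) (Y ω)) P) :
    Integrable (fun ω => Y ω ^ β) P := by
  have hm : 0 < θ * Real.exp (-θ) / (1 - Real.exp (-θ)) :=
    div_pos (mul_pos hθ (Real.exp_pos _)) (one_sub_exp_pos hθ)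
  refine (h.norm.const_mul (θ * Real.exp (-θ) / (1 - Real.exp (-θ)))⁻¹).mono'
    (hY.pow_const β).aestronglyMeasurable (ae_of_all _ fun ω => ?_)
  rw [norm_mul, Real.norm_of_nonneg (frankS_pos hθ P Y _).le, inv_mul_eq_div, le_div_iff₀ hm]
  exact mul_le_mul_of_nonneg_left (frankS_lower hθ P Y _) (norm_nonneg _)

/-- Domination of the tail ratio on the range where the slowly varying factor is controlled. -/
lemma eventually_tail_div_le {α : ℝ} {L g : ℝ → ℝ} (hL : SlowlyVarying L)
    (hFL : tail (distFn P X) ~[atTop] fun x => x ^ (-α) * L x)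
    (hg : Tendsto g atTop (𝓝 0))
    (hlim : RatioLimsupFinite L g) :
    ∃ C : ℝ, ∀ᶠ x in atTop, ∀ y, 1 ≤ y → y ≤ x * g x →
      tail (distFn P X) (x / y) ≤ C * y ^ α * tail (distFn P X) x := by
  obtain ⟨C, hC⟩ := hlim
  obtain ⟨v, hv, hveq⟩ := hFL.exists_eq_mul
  have hev : ∀ᶠ x in atTop, 1 / 2 * (x ^ (-α) * L x) ≤ tail (distFn P X) x ∧
      tail (distFn P X) x ≤ 2 * (x ^ (-α) * L x) := by
    filter_upwards [hveq, hv.eventually_const_lt (show (1 / 2 : ℝ) < 1 by norm_num),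
      hv.eventually_lt_const (show (1 : ℝ) < 2 by norm_num), eventually_gt_atTop 0]
      with x h1 h2 h3 h4
    have : 0 < x ^ (-α) * L x := mul_pos (by positivity) (hL.1 x h4)
    rw [h1, Pi.mul_apply]
    exact ⟨mul_le_mul_of_nonneg_right h2.le this.le, mul_le_mul_of_nonneg_right h3.le this.le⟩
  obtain ⟨M, hM⟩ := eventually_atTop.1 hev
  have hMpos : 0 < (max M 1)⁻¹ := by positivity
  -- Replacing the tail by x^{-α} L(x) costs a factor 2 at x/y and another at x.
  refine ⟨4 * C, ?_⟩
  filter_upwards [hC, hg.eventually_lt_const hMpos, eventually_ge_atTop M,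
    eventually_gt_atTop 0] with x hCx hgx hxM hx0 y hy1 hy2
  have hy0 : 0 < y := by linarith
  -- From y ≤ x g(x) and g(x) < 1 / max(M, 1): the smallness of g keeps x/y in the asymptotic range.
  have hz : M ≤ x / y := by
    refine (le_max_left M 1).trans ((le_div_iff₀ hy0).2 ?_)
    have : g x * max M 1 ≤ 1 := by
      rw [← le_div_iff₀ (by positivity), one_div]; exact hgx.le
    calc max M 1 * y ≤ max M 1 * (x * g x) := mul_le_mul_of_nonneg_left hy2 (by positivity)
      _ = x * (g x * max M 1) := by ring
      _ ≤ x * 1 := mul_le_mul_of_nonneg_left this hx0.le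
      _ = x := mul_one x
  have hLx := hL.1 x hx0
  have hLC : L (x / y) ≤ C * L x := (div_le_iff₀ hLx).1 (hCx y hy1 hy2)
  have hC0 : 0 < C := by
    by_contra! h
    have h1 := hL.1 (x / y) (by positivity)
    nlinarith
  calc tail (distFn P X) (x / y) ≤ 2 * ((x / y) ^ (-α) * L (x / y)) := (hM _ hz).2
    _ = 2 * (x ^ (-α) * y ^ α * L (x / y)) := by
      rw [Real.div_rpow hx0.le hy0.le, Real.rpow_neg hy0.le, div_inv_eq_mul]
    _ ≤ 2 * (x ^ (-α) * y ^ α * (C * L x)) := by gcongr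
    _ = 4 * C * y ^ α * (1 / 2 * (x ^ (-α) * L x)) := by ring
    _ ≤ 4 * C * y ^ α * tail (distFn P X) x :=
      mul_le_mul_of_nonneg_left (hM _ hxM).1 (by positivity)

/-- Potter-type bound for a nonincreasing regularly varying tail. -/
lemma RegVaryingTail.exists_potter {α ε : ℝ} (hα : 0 ≤ α) (hε : 0 < ε)
    (hF : RegVaryingTail (distFn P X) α) :
    ∃ x₀ : ℝ, 0 < x₀ ∧ ∀ z y : ℝ, x₀ ≤ z → 1 ≤ y →
      tail (distFn P X) z ≤ 2 ^ (α + ε) * y ^ (α + ε) * tail (distFn P X) (z * y) := by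
  have hlt : (2 : ℝ) ^ (-(α + ε)) < 2 ^ (-α) :=
    Real.rpow_lt_rpow_of_exponent_lt one_lt_two (by linarith)
  -- Doubling the argument costs a factor below 2^{α+ε} far out; this is iterated along z, 2z, 4z,
  -- and so on.
  have hev := ((hF 2 two_pos).eventually_const_lt hlt).and hF.eventually_pos
  obtain ⟨x₁, hx₁⟩ := eventually_atTop.1 hev
  have hB : (0 : ℝ) < 2 ^ (α + ε) := by positivity
  have hstep : ∀ z, max x₁ 1 ≤ z →
      tail (distFn P X) z ≤ 2 ^ (α + ε) * tail (distFn P X) (z * 2) := by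
    intro z hz
    obtain ⟨h1, h2⟩ := hx₁ z ((le_max_left _ _).trans hz)
    rw [lt_div_iff₀ h2, Real.rpow_neg two_pos.le, inv_mul_lt_iff₀ hB] at h1
    exact h1.le
  refine ⟨max x₁ 1, by positivity, fun z y hz hy => ?_⟩
  have hz0 : 0 < z := lt_of_lt_of_le (by positivity) hz
  have hiter : ∀ n : ℕ,
      tail (distFn P X) z ≤ (2 ^ (α + ε)) ^ n * tail (distFn P X) (z * 2 ^ n) := by
    intro n
    induction n with
    | zero => simp
    | succ n ih =>
      have h2 : z ≤ z * 2 ^ n := le_mul_of_one_le_right hz0.le (one_le_pow₀ one_le_two)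
      calc _ ≤ _ := ih
        _ ≤ (2 ^ (α + ε)) ^ n * (2 ^ (α + ε) * tail (distFn P X) (z * 2 ^ n * 2)) :=
          mul_le_mul_of_nonneg_left (hstep _ (hz.trans h2)) (by positivity)
        _ = _ := by rw [pow_succ, pow_succ]; ring_nf
  -- With 2^n ≤ y < 2^{n+1}, n + 1 doublings overshoot y; the surplus one is the prefactor 2^{α+ε}.
  obtain ⟨n, hn1, hn2⟩ := exists_nat_pow_near hy one_lt_two
  refine (hiter (n + 1)).trans ?_
  refine mul_le_mul ?_ (antitone_tail P X (mul_le_mul_of_nonneg_left hn2.le hz0.le))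
    (tail_nonneg P X _) (by positivity)
  have e : ((2 : ℝ) ^ (α + ε)) ^ n = ((2 : ℝ) ^ n) ^ (α + ε) := by
    rw [← Real.rpow_natCast, ← Real.rpow_mul two_pos.le, mul_comm, Real.rpow_mul two_pos.le,
      Real.rpow_natCast]
  rw [pow_succ', e]
  gcongr

/-- Regular variation makes the tail of X at x/c comparable to that at x, so a linear cut-off is
admissible. -/
lemma isLittleO_tail_div_const {α c : ℝ} (hc : 0 < c) (hF : RegVaryingTail (distFn P X) α)
    (hGF : tail (distFn P Y) =o[atTop] tail (distFn P X)) :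
    (fun x => tail (distFn P Y) (x / c)) =o[atTop] tail (distFn P X) := by
  have h1 := hGF.comp_tendsto (tendsto_id.atTop_div_const hc)
  refine h1.trans_isBigO ?_
  refine isBigO_of_div_tendsto_nhds ?_ _ (hF c⁻¹ (inv_pos.2 hc))
  filter_upwards [hF.eventually_pos] with x hx h0
  exact absurd h0 hx.ne'

variable [IsProbabilityMeasure P]

lemma integrable_rpow_mul_frankS_of_le (hY : Measurable Y) (hYpos : ∀ᵐ ω ∂P, 0 < Y ω)
    (hθ : 0 < θ) {α β : ℝ} (hα : 0 ≤ α) (hαβ : α ≤ β)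
    (h : Integrable (fun ω => Y ω ^ β * frankS θ (distFn P Y) (Y ω)) P) :
    Integrable (fun ω => Y ω ^ α * frankS θ (distFn P Y) (Y ω)) P := by
  have hs : ∀ y, frankS θ (distFn P Y) y ≤ θ / (1 - Real.exp (-θ)) := fun y => by
    have hc := one_sub_exp_pos hθ
    unfold frankS
    gcongr
    refine mul_le_of_le_one_right hθ.le (Real.exp_le_one_iff.2 ?_)
    nlinarith [tail_nonneg P Y y]
  refine ((integrable_const (θ / (1 - Real.exp (-θ)))).add h).mono'
    ((hY.pow_const α).mul ((measurable_frankS θ P Y).comp hY)).aestronglyMeasurable ?_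
  filter_upwards [hYpos] with ω hω
  have hp := frankS_pos hθ P Y (Y ω)
  rw [Real.norm_of_nonneg (by positivity), Pi.add_apply]
  rcases le_total (Y ω) 1 with h1 | h1
  · have := mul_le_of_le_one_left hp.le (Real.rpow_le_one hω.le h1 hα)
    have h3 : 0 ≤ Y ω ^ β * frankS θ (distFn P Y) (Y ω) := by positivity
    linarith [hs (Y ω)]
  · have := mul_le_mul_of_nonneg_right (Real.rpow_le_rpow_of_exponent_le h1 hαβ) hp.le
    linarith [hs (Y ω)]

/-- Asymptotics of the product tail, given a cut-off `φ` below which the ratio of the tails of `X`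
is dominated by an integrable power of `Y`, and beyond which the tail of `Y` is negligible. -/
lemma tendsto_integral_frankTail_div (hY : Measurable Y)
    (hYpos : ∀ᵐ ω ∂P, 0 < Y ω) (hθ : 0 < θ) {α β C : ℝ} {φ : ℝ → ℝ}
    (hF : RegVaryingTail (distFn P X) α) (hφ : Tendsto φ atTop atTop)
    (hGφ : (fun x => tail (distFn P Y) (φ x)) =o[atTop] tail (distFn P X))
    (hdom : ∀ᶠ x in atTop, ∀ y, 1 ≤ y → y ≤ φ x →
      tail (distFn P X) (x / y) ≤ C * y ^ β * tail (distFn P X) x)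
    (hint : Integrable (fun ω => Y ω ^ β) P) :
    Tendsto (fun x => (∫ ω, frankTail θ (distFn P X (x / Y ω)) (distFn P Y (Y ω)) ∂P) /
      tail (distFn P X) x) atTop
      (𝓝 (∫ ω, Y ω ^ α * frankS θ (distFn P Y) (Y ω) ∂P)) := by
  set q : ℝ → Ω → ℝ := fun x ω => frankTail θ (distFn P X (x / Y ω)) (distFn P Y (Y ω)) with hq
  set K := θ / ((1 - Real.exp (-θ)) * Real.exp (-θ)) with hK
  have hKpos : 0 < K := div_pos hθ (mul_pos (one_sub_exp_pos hθ) (Real.exp_pos _))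
  have hqm : ∀ x, Measurable (q x) := fun x => measurable_frankTail_comp P X Y hY θ x
  have hq0 : ∀ x ω, 0 ≤ q x ω := fun x ω =>
    frankTail_nonneg hθ (distFn_mem_Icc _ _ _) (distFn_mem_Icc _ _ _)
  have hq1 : ∀ x ω, q x ω ≤ 1 := fun x ω =>
    frankTail_le_one hθ (distFn_mem_Icc _ _ _) (distFn_mem_Icc _ _ _)
  have hqK : ∀ x ω, q x ω ≤ K * tail (distFn P X) (x / Y ω) := fun x ω =>
    frankTail_le hθ (distFn_mem_Icc _ _ _) (distFn_mem_Icc _ _ _)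
  have hqi : ∀ x, Integrable (q x) P := fun x =>
    (integrable_const (1 : ℝ)).mono' (hqm x).aestronglyMeasurable
      (ae_of_all _ fun ω => by rw [Real.norm_of_nonneg (hq0 x ω)]; exact hq1 x ω)
  have hS : ∀ x, MeasurableSet {ω | Y ω ≤ φ x} := fun x => measurableSet_le hY measurable_const
  have hlow : Tendsto (fun x => ∫ ω, {ω | Y ω ≤ φ x}.indicator
      (fun ω => q x ω / tail (distFn P X) x) ω ∂P) atTop
      (𝓝 (∫ ω, Y ω ^ α * frankS θ (distFn P Y) (Y ω) ∂P)) := by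
    refine tendsto_integral_filter_of_dominated_convergence
      (fun ω => K * (1 + |C| * Y ω ^ β)) ?_ ?_ ?_ ?_
    · exact .of_forall fun x =>
        (((hqm x).div_const _).indicator (hS x)).aestronglyMeasurable
    · filter_upwards [hF.eventually_pos, hdom, eventually_ge_atTop 0] with x hx hd hx0
      filter_upwards [hYpos] with ω hω
      have hb : 0 ≤ K * (1 + |C| * Y ω ^ β) := by positivity
      by_cases hm : Y ω ≤ φ x
      · rw [indicator_of_mem (show ω ∈ {ω | Y ω ≤ φ x} from hm),
          Real.norm_of_nonneg (div_nonneg (hq0 x ω) hx.le), div_le_iff₀ hx, mul_assoc]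
        refine (hqK x ω).trans (mul_le_mul_of_nonneg_left ?_ hKpos.le)
        -- For Y ≤ 1 monotonicity alone gives ratio at most 1, the summand 1 in the dominating
        -- function; the cut-off hypothesis covers Y ≥ 1.
        rcases le_total (Y ω) 1 with h1 | h1
        · refine (antitone_tail P X (le_div_self hx0 hω h1)).trans ?_
          exact le_mul_of_one_le_left hx.le (le_add_of_nonneg_right (by positivity))
        · refine (hd _ h1 hm).trans (mul_le_mul_of_nonneg_right ?_ hx.le)
          have := mul_le_mul_of_nonneg_right (le_abs_self C) (Real.rpow_nonneg hω.le β)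
          linarith
      · rw [indicator_of_notMem (show ω ∉ {ω | Y ω ≤ φ x} from hm), norm_zero]
        exact hb
    · exact ((integrable_const _).add (hint.const_mul _)).const_mul _
    · filter_upwards [hYpos] with ω hω
      have hratio : Tendsto (fun x => (1 - distFn P X (x / Y ω)) / tail (distFn P X) x) atTop
          (𝓝 (Y ω ^ α)) := by
        have := hF (Y ω)⁻¹ (inv_pos.2 hω)
        rwa [Real.inv_rpow hω.le, Real.rpow_neg hω.le, inv_inv] at this
      have hu : Tendsto (fun x => distFn P X (x / Y ω)) atTop (𝓝 1) :=
        (tendsto_distFn_atTop P X).comp (tendsto_id.atTop_div_const hω)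
      have := tendsto_frankTail_div hθ (distFn_mem_Icc P Y (Y ω)) hu hratio
      refine this.congr' ?_
      filter_upwards [hφ.eventually_ge_atTop (Y ω)] with x hx
      rw [indicator_of_mem (show ω ∈ {ω | Y ω ≤ φ x} from hx)]
  have hhigh : Tendsto (fun x => ∫ ω, {ω | Y ω ≤ φ x}ᶜ.indicator
      (fun ω => q x ω / tail (distFn P X) x) ω ∂P) atTop (𝓝 0) := by
    refine squeeze_zero (g := fun x => tail (distFn P Y) (φ x) / tail (distFn P X) x) ?_ ?_
      hGφ.tendsto_div_nhds_zero
    · exact fun x => integral_nonneg fun ω => indicator_nonneg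
        (fun ω _ => div_nonneg (hq0 x ω) (tail_nonneg P X x)) ω
    · intro x
      have hset : {ω | φ x < Y ω} = {ω | Y ω ≤ φ x}ᶜ := by ext; simp
      rw [tail_eq_real hY, hset, ← integral_indicator_one (hS x).compl, ← integral_div]
      refine integral_mono (((hqi x).div_const _).indicator (hS x).compl)
        (((integrable_const (1 : ℝ)).indicator (hS x).compl).div_const _) fun ω => ?_
      by_cases hm : ω ∈ {ω | Y ω ≤ φ x}ᶜ
      · simp only [indicator_of_mem hm, Pi.one_apply]
        exact div_le_div_of_nonneg_right (hq1 x ω) (tail_nonneg P X x)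
      · simp [indicator_of_notMem hm]
  have := hlow.add hhigh
  rw [add_zero] at this
  refine this.congr fun x => ?_
  rw [← integral_add (((hqi x).div_const _).indicator (hS x))
    (((hqi x).div_const _).indicator (hS x).compl), ← integral_div]
  exact integral_congr_ae (ae_of_all _ fun ω =>
    indicator_self_add_compl_apply _ _ ω)

/-- A nonzero limit constant is needed to turn the limit of the ratio into an asymptotic
equivalence. -/
lemma integral_rpow_mul_frankS_pos (hYpos : ∀ᵐ ω ∂P, 0 < Y ω) (hθ : 0 < θ)
    {α : ℝ} (hint : Integrable (fun ω => Y ω ^ α * frankS θ (distFn P Y) (Y ω)) P) :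
    0 < ∫ ω, Y ω ^ α * frankS θ (distFn P Y) (Y ω) ∂P := by
  have hpos : ∀ᵐ ω ∂P, 0 < Y ω ^ α * frankS θ (distFn P Y) (Y ω) := by
    filter_upwards [hYpos] with ω hω
    exact mul_pos (Real.rpow_pos_of_pos hω α) (frankS_pos hθ P Y _)
  rw [integral_pos_iff_support_of_nonneg_ae (hpos.mono fun ω h => h.le) hint]
  refine pos_iff_ne_zero.2 fun h0 => ?_
  have : ∀ᵐ ω ∂P, False := by
    filter_upwards [hpos, measure_eq_zero_iff_ae_notMem.1 h0] with ω h1 h2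
    exact h2 h1.ne'
  simp [IsProbabilityMeasure.ne_zero P] at this

end Asymptotics

end BreimanFrank

/-! ### The two moment conditions. -/

theorem corollary2p2 {Ω : Type*} [MeasurableSpace Ω] (P : Measure Ω) [IsProbabilityMeasure P]
    (X Y : Ω → ℝ) (hX : Measurable X) (hY : Measurable Y) (hYpos : ∀ᵐ ω ∂P, 0 < Y ω)
    (hG : Continuous (BreimanFrank.distFn P Y))
    (θ : ℝ) (hθ : 0 < θ) (hXY : BreimanFrank.IsFrank P X Y θ)
    (α : ℝ) (hα : 0 ≤ α) (hF : BreimanFrank.RegVaryingTail (BreimanFrank.distFn P X) α)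
    (L : ℝ → ℝ) (hL : BreimanFrank.SlowlyVarying L)
    (hFL : BreimanFrank.tail (BreimanFrank.distFn P X) ~[atTop] fun x => x ^ (-α) * L x)
    (hGF : BreimanFrank.tail (BreimanFrank.distFn P Y) =o[atTop]
      BreimanFrank.tail (BreimanFrank.distFn P X))
    (hmom :
      (∃ ε : ℝ, 0 < ε ∧
        Integrable (fun ω => Y ω ^ (α + ε) *
          BreimanFrank.frankS θ (BreimanFrank.distFn P Y) (Y ω)) P) ∨
      ((∃ g : ℝ → ℝ,
          BreimanFrank.IsSeparating (BreimanFrank.distFn P Y) (BreimanFrank.distFn P X) g ∧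
          BreimanFrank.RatioLimsupFinite L g) ∧
        Integrable (fun ω => Y ω ^ α *
          BreimanFrank.frankS θ (BreimanFrank.distFn P Y) (Y ω)) P)) :
    Integrable (fun ω => Y ω ^ α *
        BreimanFrank.frankS θ (BreimanFrank.distFn P Y) (Y ω)) P ∧
      (fun x => P.real {ω | x < X ω * Y ω}) ~[atTop]
        (fun x => (∫ ω, Y ω ^ α *
            BreimanFrank.frankS θ (BreimanFrank.distFn P Y) (Y ω) ∂P) *
          BreimanFrank.tail (BreimanFrank.distFn P X) x) := by

  have key : Integrable (fun ω => Y ω ^ α *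
        BreimanFrank.frankS θ (BreimanFrank.distFn P Y) (Y ω)) P ∧
      Tendsto (fun x => (∫ ω, BreimanFrank.frankTail θ (BreimanFrank.distFn P X (x / Y ω))
        (BreimanFrank.distFn P Y (Y ω)) ∂P) / BreimanFrank.tail (BreimanFrank.distFn P X) x) atTop
        (𝓝 (∫ ω, Y ω ^ α * BreimanFrank.frankS θ (BreimanFrank.distFn P Y) (Y ω) ∂P)) := by
    rcases hmom with ⟨ε, hε, hint⟩ | ⟨⟨g, hg, hlim⟩, hint⟩
    · refine ⟨BreimanFrank.integrable_rpow_mul_frankS_of_le hY hYpos hθ hα (by linarith) hint, ?_⟩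
      obtain ⟨x₀, hx₀, hpotter⟩ := hF.exists_potter hα hε
      refine BreimanFrank.tendsto_integral_frankTail_div (C := 2 ^ (α + ε))
        (φ := fun x => x / x₀) hY hYpos hθ hF
        (tendsto_id.atTop_div_const hx₀) (BreimanFrank.isLittleO_tail_div_const hx₀ hF hGF)
        (.of_forall fun x y hy1 hy2 => ?_)
        (BreimanFrank.integrable_rpow_of_mul_frankS hY hθ hint)
      have hy0 : 0 < y := by linarith
      -- The cut-off y ≤ x/x₀ says exactly that x/y ≥ x₀, the range of the Potter bound.
      have h := hpotter (x / y) y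
        ((le_div_iff₀ hy0).2 (by rw [mul_comm]; exact (le_div_iff₀ hx₀).1 hy2)) hy1
      rwa [div_mul_cancel₀ x hy0.ne'] at h
    · obtain ⟨C, hC⟩ := BreimanFrank.eventually_tail_div_le hL hFL hg.tendsto_zero hlim
      exact ⟨hint, BreimanFrank.tendsto_integral_frankTail_div hY hYpos hθ hF hg.mul_tendsto
        hg.tail_isLittleO hC (BreimanFrank.integrable_rpow_of_mul_frankS hY hθ hint)⟩
  refine ⟨key.1, ?_⟩
  have hE := BreimanFrank.integral_rpow_mul_frankS_pos hYpos hθ key.1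
  refine isEquivalent_of_tendsto_one ?_
  have h := key.2.div_const (∫ ω, Y ω ^ α *
    BreimanFrank.frankS θ (BreimanFrank.distFn P Y) (Y ω) ∂P)
  rw [div_self hE.ne'] at h
  refine h.congr fun x => ?_
  rw [Pi.div_apply, BreimanFrank.real_lt_mul_eq_integral hX hY hYpos hG hθ hXY, div_div, mul_comm]
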